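/- **Setting.** Let $k\ge 1$ and $M_k=\{\mathbf e_1,\dots,\mathbf e_k,\mathbf f_1,\dots,\mathbf f_k\}$ a set of markers. Let $\mathcal M=(S,s_{in},\mathrm{Obs},\mathbf P)$ be a finite-state Markov chain with initial state $s_{in}$ and observation function $\mathrm{Obs}\colon S\to 2^{M_k}$; its graph has an edge $s\to s'$ iff $\mathbf P(s,s')>0$. Paths are finite sequences of states along edges, and the length of a path is its number of edges. A path is *good* if it has length $0$ or if, for some $i$, it visits a state with marker $\mathbf e_i$ and no state with marker $\mathbf f_i$. The second half of $s_0\dots s_m$ is $s_{\lceil m/2\rceil}\dots s_m$. **Strategy.** At every step one may either *continue* (move according to $\mathbf P$) or *restart* (move to $s_{in}$). For $f\colon\mathbb N\to\mathbb N$, the strategy $\mathfrak S[f]$, which sees only observations and past actions, does the following after its $n$-th restart, $n=0,1,2,\dots$ ($n=0$: from the start): it executes the chain from $s_{in}$ in blocks of $2f(n)$ steps, and restarts as soon as, at the end of a block, the second half of the whole path executed since the last restart is not good. (If $f(n)=0$, it never restarts again.) Let $\Pr$ be the probability measure on the runs of the Markov chain induced by $\mathfrak S[f]$, and $\#\mathsf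 r\in\mathbb N\cup\{\infty\}$ the number of restarts of a run. **Parameters of $\mathcal M$.** $P_{\rm good}$ is the probability that a run of $\mathcal M$ from $s_{in}$ sees, for some $i$, the marker $\mathbf e_i$ infinitely often and $\mathbf f_i$ only finitely often. A bottom strongly connected component (BSCC) is *$i$-good* if it has a state with marker $\mathbf e_i$ and no state with marker $\mathbf f_i$; it is *good* if it is $i$-good for some $i$, and *bad* otherwise. Let $B_\gamma$ (resp. $B_\beta$) be the set of states that belong to good (resp. bad) BSCCs, and $S_\gamma$ (resp. $S_\beta$) the set of states from which $B_\gamma$ (resp. $B_\beta$) is reachable. A *progress path* for $s$ is a path of length at least $1$ starting at $s$ that * for $s\in S_\gamma\setminus B_\gamma$ (good reachability), ends in $B_\gamma$; * for $s\in B_\gamma$ (good witness), ends in a state with a marker $\mathbf e_i$ such that the BSCC of $s$ is $i$-good; * for $s\in S_\beta\setminus B_\beta$ (bad reachability), ends in $B_\beta$; * for $s\in B_\beta$ (bad witness), visits a state with marker $\mathbf f_i$ for every $i$ such that the BSCC of $s$ has a state with marker $\mathbf e_i$. For each of these four kinds, the radius ($r_\gamma,R_\gamma,r_\beta,R_\beta$,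 respectively) is the maximum, over the states $s$ of the kind, of the length of a shortest progress path of that kind for $s$; the corresponding probability ($p_\gamma,P_\gamma,p_\beta,P_\beta$) is the minimum, over the same states, of the probability that the first $r$ steps of a run from $s$ contain a progress path of that kind for $s$, where $r$ is the corresponding radius. A kind without states is left out. The *progress radius* $R_{\rm m}$ is the maximum of the four radii, and the *progress probability* $P_{\rm m}$ is the minimum of the four probabilities. **Lemma (Restarting probability).** For every such $\mathcal M$, every $f\colon\mathbb N\to\mathbb N$ and every $n\ge 0$, the probability that a run restarts again after $n$ restarts satisfies $$\Pr\bigl[\#\mathsf r\ge n+1\;\big|\;\#\mathsf r\ge n\bigr]\;\le\;1-P_{\rm good}\Bigl(1-3\,(1-P_{\rm m})^{\max(\lfloor f(n)/R_{\rm m}\rfloor-1,\;0)}\Bigr).$$ Here $f(n)$ is half the block length that the strategy uses after $n$ restarts. If $\Pr[\#\mathsf r\ge n]=0$, the conditional probability is read as $0$. (If the attempts are numbered from $1$, so that attempt $n$, the one after $n-1$ restarts, uses blocks of $2f(n)$ steps, this is the bound $\Pr[\#\mathsf r\ge n\mid\#\mathsf r\ge n-1]\le 1-P_{\rm good}\bigl(1-3(1-P_{\rm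 m})^{\lfloor f(n)/R_{\rm m}\rfloor-1}\bigr)$ for $n\ge1$, with the exponent $-1$ read as $0$.) -/

import Mathlib

open MeasureTheory ProbabilityTheory Filter
open scoped ENNReal

noncomputable section

namespace BlackBox

universe u v w

/-! ### Partially observable Markov chains and their runs -/

/-- A partially observable Markov chain with states `S` and observations `O`. The transition matrix
is given row by row: `P s` is the distribution of the successor of `s`. Finiteness of `S` is assumed
only where it is needed, because the chain induced by a strategy has infinitely many states. -/
structure MarkovChain (O : Type u) (S : Type v) where
  init : S
  obs : S → O
  P : S → PMF S

namespace MarkovChain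

variable {O : Type u} {S : Type v} (M : MarkovChain O S)

/-- The edge relation of the graph of the chain. -/
def Edge (s t : S) : Prop := 0 < M.P s t

/-- There is a path (possibly empty) from `s` to `t`. -/
def Reaches (s t : S) : Prop := Relation.ReflTransGen M.Edge s t

/-- `C` is the node set of a strongly connected component. -/
def IsSCC (C : Set S) : Prop :=
  C.Nonempty ∧ ∀ s ∈ C, ∀ t, t ∈ C ↔ M.Reaches s t ∧ M.Reaches t s

/-- `C` is the node set of a bottom strongly connected component. -/
def IsBSCC (C : Set S) : Prop :=
  M.IsSCC C ∧ ∀ s ∈ C, ∀ t, M.Edge s t → t ∈ C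

section Measure

variable [MeasurableSpace S] [MeasurableSingletonClass S] [Countable S]

/-- The distribution of the next state, given the first `n + 1` states. -/
def stepKernel (n : ℕ) : Kernel (Finset.Iic n → S) S :=
  Kernel.ofFunOfCountable fun h => (M.P (h ⟨n, Finset.mem_Iic.2 le_rfl⟩)).toMeasure

instance (n : ℕ) : IsMarkovKernel (M.stepKernel n) :=
  ⟨fun h => inferInstanceAs
    (IsProbabilityMeasure (M.P (h ⟨n, Finset.mem_Iic.2 le_rfl⟩)).toMeasure)⟩

/-- The law of the run `ρ 0, ρ 1, ρ 2, …` of the chain started in `s`. -/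
def runMeasureFrom (s : S) : Measure (ℕ → S) :=
  Kernel.traj (X := fun _ => S) M.stepKernel 0 (fun _ => s)

/-- The law of the run started in the initial state. -/
def runMeasure : Measure (ℕ → S) := M.runMeasureFrom M.init

end Measure

end MarkovChain

/-! ### Markov decision processes, strategies, and the restart process -/

/-- A partially observable Markov decision process with actions `A`. -/
structure MDP (O : Type u) (A : Type w) (S : Type v) where
  init : S
  obs : S → O
  Δ : S → A → PMF S

/-- A strategy maps an observed history `ℓ₀ a₀ ℓ₁ a₁ … aₙ₋₁ ℓₙ`, split into the list of the pairs
`(ℓᵢ, aᵢ)` and the last observation `ℓₙ`, to the next action. -/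
abbrev Strategy (O : Type u) (A : Type w) := List (O × A) → O → A

/-- An element `s₀ a₀ s₁ a₁ … aₙ₋₁ sₙ` of `(S × A)^* × S`. -/
@[ext]
structure History (S : Type v) (A : Type w) where
  past : List (S × A)
  last : S

instance (S : Type v) (A : Type w) : MeasurableSpace (History S A) := ⊤

instance (S : Type v) (A : Type w) : DiscreteMeasurableSpace (History S A) := ⟨fun _ => trivial⟩

instance (S : Type v) (A : Type w) [Countable S] [Countable A] : Countable (History S A) :=
  Function.Injective.countable (f := fun h : History S A => (h.past, h.last))
    (fun a b h => History.ext (Prod.ext_iff.1 h).1 (Prod.ext_iff.1 h).2)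

/-- The action chosen by `σ` after the history `h`; it depends on observations and actions only. -/
def MDP.choice {O : Type u} {A : Type w} {S : Type v} (D : MDP O A S) (σ : Strategy O A)
    (h : History S A) : A :=
  σ (h.past.map fun p => (D.obs p.1, p.2)) (D.obs h.last)

/-- The Markov chain on histories that the strategy `σ` induces. -/
def MDP.induced {O : Type u} {A : Type w} {S : Type v} (D : MDP O A S) (σ : Strategy O A) :
    MarkovChain O (History S A) where
  init := ⟨[], D.init⟩
  obs h := D.obs h.last
  P h := (D.Δ h.last (D.choice σ h)).map
    fun s' => ⟨h.past ++ [(h.last, D.choice σ h)], s'⟩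

/-- The two actions of the restart process. -/
inductive Action : Type
  | restart
  | continue

instance : Finite Action :=
  Finite.of_injective (fun a : Action => match a with | .restart => true | .continue => false)
    (by rintro (_ | _) (_ | _) h <;> simp_all)

/-- The restart process of a Markov chain. -/
def MarkovChain.restartMDP {O : Type u} {S : Type v} (M : MarkovChain O S) : MDP O Action S where
  init := M.init
  obs := M.obs
  Δ s a := match a with
    | .restart => PMF.pure M.init
    | .continue => M.P s

open scoped Classical in
/-- The number of restart actions in a list of labelled steps. -/
def countRestarts {T : Type*} (l : List (T × Action)) : ℕ :=
  l.countP fun p => p.2 = Action.restart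

/-- The number of restarts in a run of the chain on histories. (The histories along a run extend
one another, so this is the number of occurrences of the restart action in the run.) -/
def numRestarts {S : Type v} (ρ : ℕ → History S Action) : ℕ∞ :=
  ⨆ i, (countRestarts (ρ i).past : ℕ∞)

/-! ### Rabin languages and the strategy -/

/-- The markers `e₁, …, eₖ, f₁, …, fₖ`. -/
inductive Marker (k : ℕ) : Type
  | e (i : Fin k)
  | f (i : Fin k)

/-- The Rabin language: for some `i`, the marker `eᵢ` occurs infinitely often and `fᵢ` only finitely
often. -/
def RabinLanguage (k : ℕ) : Set (ℕ → Set (Marker k)) :=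
  {x | ∃ i, (∃ᶠ j in atTop, Marker.e i ∈ x j) ∧ ∀ᶠ j in atTop, Marker.f i ∉ x j}

/-- Goodness of a finite path, given by the list of the observations of its states: it has length `0`
(a single state), or for some `i` it visits the marker `eᵢ` and does not visit `fᵢ`. -/
def IsGoodPath {k : ℕ} (π : List (Set (Marker k))) : Prop :=
  ∃ i, π.length ≤ 1 ∨ ((∃ α ∈ π, Marker.e i ∈ α) ∧ ∀ α ∈ π, Marker.f i ∉ α)

/-- The length (number of steps) of the path with the given list of states. -/
def pathLength {T : Type*} (π : List T) : ℕ := π.length - 1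

/-- The second half `s_⌈m/2⌉ … s_m` of a path `s₀ … s_m`. -/
def secondHalf {T : Type*} (π : List T) : List T := π.drop ((pathLength π + 1) / 2)

open scoped Classical in
/-- The observations of the path executed since the last restart. -/
def currentPath {O : Type u} (h : List (O × Action)) (ℓ : O) : List O :=
  (h.rtakeWhile fun p => p.2 = Action.continue).map Prod.fst ++ [ℓ]

open scoped Classical in
/-- The strategy `𝔖[f]`: after `n` restarts, sample blocks of `2 * f n` steps, and restart as soon as
the second half of the path executed since the last restart is not good at the end of a block. -/
def strategy {k : ℕ} (f : ℕ → ℕ) : Strategy (Set (Marker k)) Action := fun h ℓ =>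
  if 2 * f (countRestarts h) ∣ pathLength (currentPath h ℓ) ∧
      ¬ IsGoodPath (secondHalf (currentPath h ℓ))
  then .restart else .continue

/-! ### Progress radius and progress probability -/

namespace MarkovChain

variable {k : ℕ} {S : Type v} (M : MarkovChain (Set (Marker k)) S)

/-- The set of states `C` has a state marked `eᵢ` and no state marked `fᵢ`. -/
def IsGoodFor (i : Fin k) (C : Set S) : Prop :=
  (∃ s ∈ C, Marker.e i ∈ M.obs s) ∧ ∀ s ∈ C, Marker.f i ∉ M.obs s

/-- The states that belong to good BSCCs. -/
def goodStates : Set S := {s | ∃ C, M.IsBSCC C ∧ s ∈ C ∧ ∃ i, M.IsGoodFor i C}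

/-- The states that belong to bad BSCCs. -/
def badStates : Set S := {s | ∃ C, M.IsBSCC C ∧ s ∈ C ∧ ∀ i, ¬ M.IsGoodFor i C}

/-- The states from which `T` can be reached. -/
def canReach (T : Set S) : Set S := {s | ∃ t ∈ T, M.Reaches s t}

/-- `π` is the list of states of a non-empty path (at least one step) that starts at `s`. -/
def IsNonemptyPathFrom (s : S) (π : List S) : Prop :=
  π.head? = some s ∧ π.IsChain M.Edge ∧ 1 ≤ pathLength π

/-- Progress paths for a state outside `T`: those that end in `T`. -/
def IsReachPath (T : Set S) (s : S) (π : List S) : Prop :=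
  M.IsNonemptyPathFrom s π ∧ ∃ t ∈ T, π.getLast? = some t

/-- Progress paths for a state `s` of a good BSCC: those that end in a state marked `eᵢ`, for an `i`
such that the BSCC of `s` is good for `i`. -/
def IsGoodWitnessPath (s : S) (π : List S) : Prop :=
  M.IsNonemptyPathFrom s π ∧
    ∃ C, M.IsBSCC C ∧ s ∈ C ∧
      ∃ i, M.IsGoodFor i C ∧ ∃ t, π.getLast? = some t ∧ Marker.e i ∈ M.obs t

/-- Progress paths for a state `s` of a bad BSCC: those that visit a state marked `fᵢ` for every `i`
such that the BSCC of `s` has a state marked `eᵢ` (so all non-empty paths from `s`, if there is no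
such `i`). -/
def IsBadWitnessPath (s : S) (π : List S) : Prop :=
  M.IsNonemptyPathFrom s π ∧
    ∃ C, M.IsBSCC C ∧ s ∈ C ∧
      ∀ i, (∃ t ∈ C, Marker.e i ∈ M.obs t) → ∃ t ∈ π, Marker.f i ∈ M.obs t

/-- The maximum over `s ∈ A` of the length of a shortest progress path for `s`; it is `0`, and so has
no effect on the maximum below, if `A` is empty. -/
def radius (A : Set S) (Prog : S → List S → Prop) : ℕ :=
  sSup ((fun s => sInf (pathLength '' {π | Prog s π})) '' A)

/-- `r_γ` -/
def goodReachRadius : ℕ :=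
  radius (M.canReach M.goodStates \ M.goodStates) (M.IsReachPath M.goodStates)

/-- `R_γ` -/
def goodWitnessRadius : ℕ := radius M.goodStates M.IsGoodWitnessPath

/-- `r_β` -/
def badReachRadius : ℕ :=
  radius (M.canReach M.badStates \ M.badStates) (M.IsReachPath M.badStates)

/-- `R_β` -/
def badWitnessRadius : ℕ := radius M.badStates M.IsBadWitnessPath

/-- The progress radius `R_m`. -/
def progressRadius : ℕ :=
  max (max M.goodReachRadius M.goodWitnessRadius) (max M.badReachRadius M.badWitnessRadius)

section Measure

variable [MeasurableSpace S] [MeasurableSingletonClass S] [Countable S]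

/-- The minimum over `s ∈ A` of the probability that the first `R` steps of a run from `s` contain a
progress path for `s`; it is `∞`, and so has no effect on the minimum below, if `A` is empty. -/
def minProb (A : Set S) (Prog : S → List S → Prop) (R : ℕ) : ℝ≥0∞ :=
  ⨅ s ∈ A, M.runMeasureFrom s {ρ | ∃ m ≤ R, Prog s ((List.range (m + 1)).map ρ)}

/-- `p_γ` -/
def goodReachProb : ℝ≥0∞ :=
  M.minProb (M.canReach M.goodStates \ M.goodStates) (M.IsReachPath M.goodStates)
    M.goodReachRadius

/-- `P_γ` -/
def goodWitnessProb : ℝ≥0∞ := M.minProb M.goodStates M.IsGoodWitnessPath M.goodWitnessRadius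

/-- `p_β` -/
def badReachProb : ℝ≥0∞ :=
  M.minProb (M.canReach M.badStates \ M.badStates) (M.IsReachPath M.badStates) M.badReachRadius

/-- `P_β` -/
def badWitnessProb : ℝ≥0∞ := M.minProb M.badStates M.IsBadWitnessPath M.badWitnessRadius

/-- The progress probability `P_m`. -/
def progressProb : ℝ :=
  (min (min M.goodReachProb M.goodWitnessProb) (min M.badReachProb M.badWitnessProb)).toReal

/-- `P_good`, the probability of the good runs. -/
def goodProb : ℝ := M.runMeasure.real {ρ | (fun j => M.obs (ρ j)) ∈ RabinLanguage k}

end Measure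

end MarkovChain

end BlackBox

end

open MeasureTheory ProbabilityTheory Filter
open scoped ENNReal

noncomputable section

namespace BlackBox

namespace MarkovChain

/-! ### Path measures: cylinders, first-step decomposition and the Markov property. -/

section Runs

universe u v

variable {O : Type u} {S : Type v}

/-! After the `n`-th restart the controlled process imitates `M` from its initial state until the
strategy rejects the current path. So, by the Markov property at that restart, the conditional
probability of another restart is at most the probability that a run of `M` has a rejected prefix
for block parameter `b = f n` (`runMeasureFrom_restartsBy_le`,
`runMeasure_restartsAtLeast_succ_le`).

For the latter, let `h` be the probability of ever entering a good BSCC, `q = 1 - P_m` and `N = ⌊b /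
R_m⌋`. A rejected run either never enters a good BSCC (probability `1 - h`), or enters one but not
within the first `N * R_m` steps (at most `q ^ N * h`), or is in a good BSCC from time `b` on. In
the last case it is rejected at some length `2 * b * J` with `J ≥ 1`, and its second half, of `b *
J` steps inside the BSCC, meets no witness state after its first state. That costs at most `q ^ (N *
J) * h` for each `J`. Summing the geometric series gives `1 - h + h * (q ^ N + q ^ N / (1 - q ^
N))`, which is at most `1 - h * (1 - 3 * q ^ (N - 1))` when `3 * q ^ (N - 1) ≤ 1`; otherwise the
claimed bound is at least `1`. Finally `P_good ≤ h` (`goodProb_le`), because almost surely the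
states seen infinitely often form a BSCC. -/

/-- Prepend a state to a run. -/
def consRun (s : S) (ρ : ℕ → S) : ℕ → S
  | 0 => s
  | n + 1 => ρ n

@[simp] theorem consRun_zero (s : S) (ρ : ℕ → S) : consRun s ρ 0 = s := rfl

@[simp] theorem consRun_succ (s : S) (ρ : ℕ → S) (n : ℕ) : consRun s ρ (n + 1) = ρ n := rfl

/-- Drop the first `m` states of a run. -/
def shiftRun (m : ℕ) (ρ : ℕ → S) : ℕ → S := fun i => ρ (m + i)

@[simp] theorem shiftRun_apply (m : ℕ) (ρ : ℕ → S) (i : ℕ) : shiftRun m ρ i = ρ (m + i) := rfl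

theorem shiftRun_succ_consRun (m : ℕ) (s : S) (ρ : ℕ → S) :
    shiftRun (m + 1) (consRun s ρ) = shiftRun m ρ := by
  funext i
  rw [shiftRun_apply, Nat.add_right_comm]
  rfl

section

variable [MeasurableSpace S]

theorem measurable_consRun (s : S) : Measurable (consRun s) := by
  refine measurable_pi_iff.2 fun i => ?_
  cases i with
  | zero => exact measurable_const
  | succ n => exact measurable_pi_apply n

theorem measurable_shiftRun (m : ℕ) : Measurable (shiftRun (S := S) m) := by
  unfold shiftRun
  fun_prop

theorem measurableSet_cylinder [MeasurableSingletonClass S] (n : ℕ) (x : ℕ → S) :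
    MeasurableSet {ρ : ℕ → S | ∀ i ≤ n, ρ i = x i} := by
  measurability

end

variable (M : MarkovChain O S)
variable [MeasurableSpace S] [MeasurableSingletonClass S] [Countable S]

instance (s : S) : IsProbabilityMeasure (M.runMeasureFrom s) :=
  inferInstanceAs (IsProbabilityMeasure (Kernel.traj (X := fun _ => S) M.stepKernel 0 _))

instance : IsProbabilityMeasure M.runMeasure :=
  inferInstanceAs (IsProbabilityMeasure (M.runMeasureFrom M.init))

theorem traj_ae_frestrictLe (n : ℕ) (y : Finset.Iic n → S) :
    ∀ᵐ z ∂Kernel.traj (X := fun _ => S) M.stepKernel n y, Preorder.frestrictLe n z = y := by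
  have h := Kernel.traj_map_frestrictLe_of_le (X := fun _ => S) (κ := M.stepKernel) (le_refl n)
  have h2 := DFunLike.congr_fun h y
  rw [Kernel.deterministic_apply, Kernel.map_apply _ (by fun_prop)] at h2
  have h3 : ∀ᵐ z ∂(Kernel.traj (X := fun _ => S) M.stepKernel n y).map
      (Preorder.frestrictLe n), z = y := by
    rw [h2]
    exact (ae_dirac_iff (measurableSet_eq)).2 rfl
  exact ae_of_ae_map (by fun_prop) h3

theorem traj_next (n : ℕ) (y : Finset.Iic n → S) (t : S) :
    Kernel.traj (X := fun _ => S) M.stepKernel n y {z | z (n + 1) = t} =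
      M.P (y ⟨n, Finset.mem_Iic.2 le_rfl⟩) t := by
  have h := congrArg (fun μ : Measure S => μ {t}) (DFunLike.congr_fun
    (Kernel.map_traj_succ_self (X := fun _ => S) (κ := M.stepKernel) (a := n)) y)
  beta_reduce at h
  rw [Kernel.map_apply' _ (by fun_prop) _ (measurableSet_singleton t)] at h
  refine h.trans ?_
  exact PMF.toMeasure_apply_singleton _ _ (measurableSet_singleton t)

theorem runMeasureFrom_ae_zero (s : S) : ∀ᵐ ρ ∂M.runMeasureFrom s, ρ 0 = s := by
  filter_upwards [M.traj_ae_frestrictLe 0 (fun _ => s)] with ρ h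
  exact congrFun h ⟨0, Finset.mem_Iic.2 le_rfl⟩

/-- The run measure, disintegrated along the first `n + 1` states. -/
theorem runMeasureFrom_eq_lintegral_traj (s : S) (n : ℕ) {E : Set (ℕ → S)} (hE : MeasurableSet E) :
    M.runMeasureFrom s E =
      ∫⁻ ρ, Kernel.traj (X := fun _ => S) M.stepKernel n (Preorder.frestrictLe n ρ) E
        ∂M.runMeasureFrom s := by
  have h := congrArg (fun μ : Measure (ℕ → S) => μ E) (DFunLike.congr_fun
    (Kernel.traj_comp_partialTraj (X := fun _ => S) (κ := M.stepKernel) (Nat.zero_le n))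
    fun _ => s)
  beta_reduce at h
  rw [Kernel.comp_apply' _ _ _ hE, ← Kernel.traj_map_frestrictLe_apply,
    lintegral_map (Kernel.measurable_coe _ hE) (by fun_prop)] at h
  exact h.symm

theorem runMeasureFrom_cylinder_zero (s : S) (x : ℕ → S) [Decidable (x 0 = s)] :
    M.runMeasureFrom s {ρ | ∀ i ≤ 0, ρ i = x i} = if x 0 = s then 1 else 0 := by
  split_ifs with h
  · rw [← prob_compl_eq_zero_iff (measurableSet_cylinder 0 x)]
    filter_upwards [M.runMeasureFrom_ae_zero s] with ρ hρ
    simp [hρ, h]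
  · refine measure_eq_zero_iff_ae_notMem.2 ?_
    filter_upwards [M.runMeasureFrom_ae_zero s] with ρ hρ
    simpa [hρ] using fun h' => h h'.symm

theorem runMeasureFrom_cylinder_succ (s : S) (n : ℕ) (x : ℕ → S) :
    M.runMeasureFrom s {ρ | ∀ i ≤ n + 1, ρ i = x i} =
      M.runMeasureFrom s {ρ | ∀ i ≤ n, ρ i = x i} * M.P (x n) (x (n + 1)) := by
  rw [M.runMeasureFrom_eq_lintegral_traj s n (measurableSet_cylinder (n + 1) x)]
  have : ∀ ρ : ℕ → S, Kernel.traj (X := fun _ => S) M.stepKernel n (Preorder.frestrictLe n ρ)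
      {ρ | ∀ i ≤ n + 1, ρ i = x i} =
      {ρ | ∀ i ≤ n, ρ i = x i}.indicator (fun _ => M.P (x n) (x (n + 1))) ρ := by
    intro ρ
    by_cases h : ∀ i ≤ n, ρ i = x i
    · rw [Set.indicator_of_mem (by exact h), ← h n le_rfl]
      refine Eq.trans (measure_congr (eventuallyEq_set.2 ?_)) (M.traj_next n (Preorder.frestrictLe n ρ) (x (n + 1)))
      filter_upwards [M.traj_ae_frestrictLe n (Preorder.frestrictLe n ρ)] with z hz
      refine ⟨fun hx => hx (n + 1) le_rfl, fun hx i hi => ?_⟩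
      rcases Nat.le_succ_iff.1 hi with hi | rfl
      · exact (congrFun hz ⟨i, Finset.mem_Iic.2 hi⟩).trans (h i hi)
      · exact hx
    · rw [Set.indicator_of_notMem (by exact h)]
      refine measure_eq_zero_iff_ae_notMem.2 ?_
      filter_upwards [M.traj_ae_frestrictLe n (Preorder.frestrictLe n ρ)] with z hz hx
      exact h fun i hi => (congrFun hz ⟨i, Finset.mem_Iic.2 hi⟩).symm.trans (hx i (by omega))
  simp_rw [this]
  rw [lintegral_indicator_const (measurableSet_cylinder n x), mul_comm]

/-- The transition matrix extends a cylinder at its end; induction moves the splitting point to the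
first step, as `runMeasureFrom_step` needs it. -/
theorem runMeasureFrom_cylinder_cons (s : S) (n : ℕ) (x : ℕ → S) :
    M.runMeasureFrom s {ρ | ∀ i ≤ n + 1, ρ i = x i} =
      M.runMeasureFrom s {ρ | ∀ i ≤ 0, ρ i = x i} * (M.P s (x 1) *
        M.runMeasureFrom (x 1) {ρ | ∀ i ≤ n, ρ i = x (i + 1)}) := by
  classical
  induction n with
  | zero =>
    rw [M.runMeasureFrom_cylinder_succ, M.runMeasureFrom_cylinder_zero,
      M.runMeasureFrom_cylinder_zero (x 1) fun i => x (i + 1)]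
    split_ifs with h <;> simp_all
  | succ n ih =>
    rw [M.runMeasureFrom_cylinder_succ, ih,
      M.runMeasureFrom_cylinder_succ (x 1) n fun i => x (i + 1)]
    simp only [mul_assoc]

/-- Finite measures on runs that agree on the cylinders of single paths are equal. -/
theorem ext_of_cylinder {μ ν : Measure (ℕ → S)} [IsFiniteMeasure μ] [IsFiniteMeasure ν]
    (h : ∀ (n : ℕ) (x : ℕ → S), μ {ρ | ∀ i ≤ n, ρ i = x i} = ν {ρ | ∀ i ≤ n, ρ i = x i}) : μ = ν := by
  have hm : ∀ n, μ.map (Preorder.frestrictLe n) = ν.map (Preorder.frestrictLe n) := by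
    intro n
    refine Measure.ext_of_singleton fun y => ?_
    rw [Measure.map_apply (by fun_prop) (measurableSet_singleton y),
      Measure.map_apply (by fun_prop) (measurableSet_singleton y)]
    rcases isEmpty_or_nonempty S with hS | ⟨⟨s₀⟩⟩
    · exact (hS.false (y ⟨n, Finset.mem_Iic.2 le_rfl⟩)).elim
    have : Preorder.frestrictLe (π := fun _ => S) n ⁻¹' {y} =
        {ρ | ∀ i ≤ n, ρ i = (fun i => if hi : i ≤ n then y ⟨i, Finset.mem_Iic.2 hi⟩ else s₀) i} := by
      ext ρ
      constructor
      · rintro hρ i hi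
        simp only [hi, dif_pos]
        exact congrFun hρ ⟨i, Finset.mem_Iic.2 hi⟩
      · intro hρ
        funext i
        exact (hρ i (Finset.mem_Iic.1 i.2)).trans (dif_pos (Finset.mem_Iic.1 i.2))
    rw [this]
    exact h _ _
  -- Every finite set of times lies in an initial segment, so the marginals in `hm` determine all
  -- finite-dimensional ones.
  refine IsProjectiveLimit.unique (P := fun I => μ.map I.restrict) (fun I => rfl) fun I => ?_
  have hI : (I.restrict : (ℕ → S) → _) =
      Finset.restrict₂ (π := fun _ => S) (Finset.subset_Iic_sup_id I) ∘
        Preorder.frestrictLe (I.sup id) := rfl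
  change ν.map I.restrict = μ.map I.restrict
  rw [hI, ← Measure.map_map (by fun_prop) (by fun_prop), ← Measure.map_map (by fun_prop)
    (by fun_prop), hm]

/-- First-step decomposition of the run measure. -/
theorem runMeasureFrom_step (s : S) {E : Set (ℕ → S)} (hE : MeasurableSet E) :
    M.runMeasureFrom s E = ∑' t, M.P s t * M.runMeasureFrom t (consRun s ⁻¹' E) := by
  let ν : Measure (ℕ → S) := Measure.sum fun t => M.P s t • (M.runMeasureFrom t).map (consRun s)
  have hν : ∀ {A : Set (ℕ → S)}, MeasurableSet A →
      ν A = ∑' t, M.P s t * M.runMeasureFrom t (consRun s ⁻¹' A) := by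
    intro A hA
    simp only [ν, Measure.sum_apply _ hA, Measure.smul_apply, smul_eq_mul,
      Measure.map_apply (measurable_consRun s) hA]
  have : IsFiniteMeasure ν := ⟨by rw [hν MeasurableSet.univ]; simp [PMF.tsum_coe]⟩
  suffices M.runMeasureFrom s = ν by rw [← hν hE, ← this]
  classical
  have h0 : ∀ x : ℕ → S, x 0 ≠ s → ∀ n, consRun s ⁻¹' {ρ | ∀ i ≤ n, ρ i = x i} = ∅ := by
    intro x hx n
    ext ρ
    simp only [Set.mem_preimage, Set.mem_ofPred_eq, Set.mem_empty_iff_false, iff_false]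
    exact fun h => hx (h 0 (Nat.zero_le _)).symm
  refine ext_of_cylinder fun n x => ?_
  rw [hν (measurableSet_cylinder n x)]
  cases n with
  | zero =>
    rw [M.runMeasureFrom_cylinder_zero]
    split_ifs with h
    · have : consRun s ⁻¹' {ρ | ∀ i ≤ 0, ρ i = x i} = Set.univ := by
        ext ρ; simp [h]
      simp only [this, measure_univ, mul_one, PMF.tsum_coe]
    · simp only [h0 x h 0, measure_empty, mul_zero, tsum_zero]
  | succ n =>
    rw [M.runMeasureFrom_cylinder_cons, M.runMeasureFrom_cylinder_zero]
    split_ifs with h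
    · rw [one_mul, tsum_eq_single (x 1)]
      · congr 2
        ext ρ
        constructor
        · intro hρ i hi
          cases i with
          | zero => exact h.symm
          | succ i => exact hρ i (by omega)
        · exact fun hρ i hi => hρ (i + 1) (by omega)
      · intro t ht
        convert mul_zero _
        refine measure_eq_zero_iff_ae_notMem.2 ?_
        filter_upwards [M.runMeasureFrom_ae_zero t] with ρ hρ hx
        exact ht (hρ.symm.trans (hx 1 (by omega)))
    · simp [h0 x h (n + 1)]

/-- The Markov property, in the form of a comparison of two events after time `m`. -/
theorem runMeasureFrom_inter_shift_le {E E' : Set (ℕ → S)} (hE : MeasurableSet E)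
    (hE' : MeasurableSet E') (c : ℝ≥0∞) (m : ℕ) :
    ∀ (s : S) {F : Set (ℕ → S)}, MeasurableSet F → DependsOn (· ∈ F) (Set.Iic m) →
      (∀ ρ ∈ F, M.runMeasureFrom (ρ m) E ≤ c * M.runMeasureFrom (ρ m) E') →
      M.runMeasureFrom s (F ∩ shiftRun m ⁻¹' E) ≤ c * M.runMeasureFrom s (F ∩ shiftRun m ⁻¹' E') := by
  have hsh : shiftRun (S := S) 0 = id := by funext ρ i; simp
  induction m with
  | zero =>
    intro s F _ hd h
    rw [hsh, Set.preimage_id, Set.preimage_id]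
    have hF : ∀ ρ ρ' : ℕ → S, ρ 0 = ρ' 0 → (ρ ∈ F) = (ρ' ∈ F) := fun ρ ρ' h' =>
      hd fun i hi => by obtain rfl : i = 0 := Nat.le_zero.1 hi; exact h'
    by_cases hs : (fun _ => s) ∈ F
    · have : ∀ A : Set (ℕ → S), M.runMeasureFrom s (F ∩ A) = M.runMeasureFrom s A := by
        intro A
        refine measure_congr (eventuallyEq_set.2 ?_)
        filter_upwards [M.runMeasureFrom_ae_zero s] with ρ hρ
        refine ⟨fun x => x.2, fun x => ⟨?_, x⟩⟩
        rw [hF ρ (fun _ => s) hρ]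
        exact hs
      simpa only [this] using h (fun _ => s) hs
    · refine le_of_eq_of_le ?_ zero_le
      refine measure_eq_zero_iff_ae_notMem.2 ?_
      filter_upwards [M.runMeasureFrom_ae_zero s] with ρ hρ hx
      have := hx.1
      rw [hF ρ (fun _ => s) hρ] at this
      exact hs this
  | succ m ih =>
    intro s F hF hd h
    rw [M.runMeasureFrom_step s (hF.inter (measurable_shiftRun _ hE)),
      M.runMeasureFrom_step s (hF.inter (measurable_shiftRun _ hE')), ← ENNReal.tsum_mul_left]
    -- After conditioning on the first step to `t`, the preimage of `F` depends on one coordinate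
    -- fewer, so the induction hypothesis applies term by term.
    refine ENNReal.tsum_le_tsum fun t => ?_
    have hpre : ∀ A : Set (ℕ → S), consRun s ⁻¹' (F ∩ shiftRun (m + 1) ⁻¹' A) =
        consRun s ⁻¹' F ∩ shiftRun m ⁻¹' A := by
      intro A
      ext ρ
      simp [shiftRun_succ_consRun]
    rw [hpre, hpre, mul_left_comm]
    gcongr
    refine ih t (measurable_consRun s hF) (fun ρ ρ' h' => ?_) fun ρ hρ => h (consRun s ρ) hρ
    refine hd (x := consRun s ρ) (y := consRun s ρ') fun i hi => ?_
    cases i with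
    | zero => rfl
    | succ i => exact h' i (Nat.succ_le_succ_iff.1 hi)

/-- Almost every run follows the edges of the graph. -/
theorem runMeasureFrom_ae_edge (s : S) :
    ∀ᵐ ρ ∂M.runMeasureFrom s, ∀ i, M.Edge (ρ i) (ρ (i + 1)) := by
  refine ae_all_iff.2 fun i => ?_
  change M.runMeasureFrom s {ρ | ¬ M.Edge (ρ i) (ρ (i + 1))} = 0
  have hm0 : MeasurableSet {ρ : ℕ → S | ¬ M.Edge (ρ 0) (ρ 1)} :=
    (measurableSet_setOfPred.2 (measurable_of_countable fun p : S × S => ¬ M.Edge p.1 p.2)).preimage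
      (f := fun ρ : ℕ → S => (ρ 0, ρ 1)) (by fun_prop)
  have h0 : ∀ t, M.runMeasureFrom t {ρ | ¬ M.Edge (ρ 0) (ρ 1)} = 0 := by
    intro t
    rw [M.runMeasureFrom_step t hm0, ENNReal.tsum_eq_zero]
    intro t'
    by_cases he : M.Edge t t'
    · convert mul_zero _
      refine measure_eq_zero_iff_ae_notMem.2 ?_
      filter_upwards [M.runMeasureFrom_ae_zero t'] with ρ hρ hx
      apply hx
      rw [consRun_zero, consRun_succ, hρ]
      exact he
    · rw [Edge, not_lt, nonpos_iff_eq_zero] at he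
      simp [he]
  have := M.runMeasureFrom_inter_shift_le hm0 MeasurableSet.univ 0 i s MeasurableSet.univ
    (fun _ _ _ => rfl) (fun ρ _ => by simp [h0])
  simpa using this

end Runs

/-! ### Recurrence: almost every run settles in a BSCC. -/

section Recurrence

universe u v

variable {O : Type u} {S : Type v} (M : MarkovChain O S)
variable [MeasurableSpace S] [MeasurableSingletonClass S]

/-- Almost surely, if `s` is visited infinitely often and `t` is a successor of `s`, then `t` is
visited infinitely often. -/
theorem runMeasureFrom_ae_frequently_of_edge [Countable S] (s₀ s t : S) (hst : M.Edge s t) :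
    ∀ᵐ ρ ∂M.runMeasureFrom s₀, (∃ᶠ j in atTop, ρ j = s) → ∃ᶠ j in atTop, ρ j = t := by
  let A : ℕ → Set (ℕ → S) := fun n => {ρ | ρ n = t}
  have hA : ∀ n, MeasurableSet[Filtration.piLE (X := fun _ => S) n] (A n) := by
    intro n
    rw [Filtration.piLE_eq_comap_frestrictLe]
    exact ⟨(fun x => x ⟨n, Finset.mem_Iic.2 le_rfl⟩) ⁻¹' {t},
      (measurable_pi_apply _) (measurableSet_singleton t), rfl⟩
  have hA' : ∀ n, MeasurableSet (A n) := fun n => Filtration.le _ n _ (hA n)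
  have hcond : ∀ n, (M.runMeasureFrom s₀)[(A (n + 1)).indicator (1 : (ℕ → S) → ℝ) |
      Filtration.piLE (X := fun _ => S) n] =ᵐ[M.runMeasureFrom s₀]
      fun ρ => (M.P (ρ n) t).toReal := by
    intro n
    refine (Kernel.condExp_traj (X := fun _ => S) (κ := M.stepKernel) (Nat.zero_le n)
      (x₀ := fun _ => s₀) ?_).trans (Eventually.of_forall fun ρ => ?_)
    · exact (integrable_const (1 : ℝ)).indicator (hA' (n + 1))
    · beta_reduce
      rw [integral_indicator_one (hA' (n + 1)), Measure.real]
      exact congrArg ENNReal.toReal (M.traj_next n (Preorder.frestrictLe n ρ) t)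
  -- Lévy's conditional Borel–Cantelli lemma: `t` recurs if the conditional probabilities `M.P (ρ j)
  -- t` have a divergent sum. They do, as the fixed positive value `M.P s t` occurs infinitely
  -- often.
  filter_upwards [ae_mem_limsup_atTop_iff (M.runMeasureFrom s₀) hA, ae_all_iff.2 hcond]
    with ρ hρ hc hs
  have hlim : ρ ∈ limsup A atTop := by
    refine hρ.2 ?_
    simp only [hc]
    have hp : 0 < (M.P s t).toReal :=
      ENNReal.toReal_pos hst.ne' (PMF.apply_ne_top _ _)
    have hnn : ∀ j, 0 ≤ (M.P (ρ j) t).toReal := fun j => ENNReal.toReal_nonneg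
    refine (not_summable_iff_tendsto_nat_atTop_of_nonneg hnn).1 fun hsum => ?_
    have h0 := hsum.tendsto_atTop_zero.eventually (gt_mem_nhds hp)
    obtain ⟨j, hj, hj'⟩ := (hs.and_eventually h0).exists
    simp [hj] at hj'
  rw [mem_limsup_iff_frequently_mem] at hlim
  exact hlim

/-- Almost surely, the set of the states visited infinitely often is a bottom strongly connected
component. -/
theorem runMeasureFrom_ae_isBSCC_frequently [Finite S] (s₀ : S) :
    ∀ᵐ ρ ∂M.runMeasureFrom s₀, M.IsBSCC {s | ∃ᶠ j in atTop, ρ j = s} := by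
  have h : ∀ᵐ ρ ∂M.runMeasureFrom s₀, ∀ s t, M.Edge s t →
      (∃ᶠ j in atTop, ρ j = s) → ∃ᶠ j in atTop, ρ j = t := by
    rw [ae_all_iff]; intro s
    rw [ae_all_iff]; intro t
    by_cases hst : M.Edge s t
    · filter_upwards [M.runMeasureFrom_ae_frequently_of_edge s₀ s t hst] with ρ hρ _ using hρ
    · exact Eventually.of_forall fun _ he => absurd he hst
  filter_upwards [h, M.runMeasureFrom_ae_edge s₀] with ρ hρ he
  have hreach : ∀ s t, M.Reaches s t →
      (∃ᶠ j in atTop, ρ j = s) → ∃ᶠ j in atTop, ρ j = t := by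
    intro s t hst hs
    induction hst with
    | refl => exact hs
    | tail _ h ih => exact hρ _ _ h ih
  have hpath : ∀ i j, i ≤ j → M.Reaches (ρ i) (ρ j) := by
    intro i j hij
    induction j, hij using Nat.le_induction with
    | base => exact Relation.ReflTransGen.refl
    | succ j _ ih => exact ih.tail (he j)
  have hconn : ∀ s t, (∃ᶠ j in atTop, ρ j = s) → (∃ᶠ j in atTop, ρ j = t) → M.Reaches s t := by
    intro s t hs ht
    obtain ⟨i, rfl⟩ := hs.exists
    obtain ⟨j, hij, rfl⟩ := (frequently_atTop.1 ht) i
    exact hpath i j hij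
  refine ⟨⟨?_, fun s hs t => ⟨fun ht => ⟨hconn s t hs ht, hconn t s ht hs⟩,
    fun ht => hreach s t ht.1 hs⟩⟩, fun s hs t hst => hρ s t hst hs⟩
  -- Nonemptiness is the pigeonhole principle on the finite state space.
  have : ∃ᶠ j in atTop, ∃ s, ρ j = s := Frequently.of_forall fun j => ⟨ρ j, rfl⟩
  exact frequently_exists.1 this

end Recurrence

/-! ### Good runs enter a good BSCC. -/

section Rabin

universe v

variable {k : ℕ} {S : Type v} (M : MarkovChain (Set (Marker k)) S)

theorem IsSCC.eq_of_mem {C C' : Set S} (hC : M.IsSCC C) (hC' : M.IsSCC C') {s : S} (hs : s ∈ C)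
    (hs' : s ∈ C') : C = C' := by
  ext t
  rw [hC.2 s hs t, hC'.2 s hs' t]

/-- The runs that visit `A`. -/
def visits (A : Set S) : Set (ℕ → S) := {ρ | ∃ m, ρ m ∈ A}

variable [Finite S] [MeasurableSpace S] [MeasurableSingletonClass S]

/-- The set of recurrent states is almost surely a BSCC. If `eᵢ` recurs and `fᵢ` does not, some
recurrent state carries `eᵢ` and none carries `fᵢ`, so this BSCC is good. -/
theorem goodProb_le : M.goodProb ≤ M.runMeasure.real (visits M.goodStates) := by
  refine ENNReal.toReal_mono (measure_ne_top _ _) (measure_mono_ae ?_)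
  filter_upwards [M.runMeasureFrom_ae_isBSCC_frequently M.init] with ρ hρ hR
  obtain ⟨i, he, hf⟩ := hR
  obtain ⟨s, hs⟩ : ∃ s, ∃ᶠ j in atTop, ρ j = s ∧ Marker.e i ∈ M.obs s := by
    refine frequently_exists.1 (he.mono fun j hj => ⟨ρ j, rfl, hj⟩)
  obtain ⟨m, hm, hm'⟩ := hs.exists
  refine ⟨m, {s | ∃ᶠ j in atTop, ρ j = s}, hρ, ?_, i, ⟨s, hs.mono fun j hj => hj.1, hm'⟩, ?_⟩
  · rw [hm]
    exact hs.mono fun j hj => hj.1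
  · intro t ht htf
    obtain ⟨j, hj, hj'⟩ := (Frequently.and_eventually ht hf).exists
    rw [← hj] at htf
    exact hj' htf

end Rabin

/-! ### Exponential decay of the probability of making no progress. -/

section Progress

universe v

/-- Such an event is the preimage of a set in a countable space of finite prefixes, where all sets
are measurable. -/
theorem measurableSet_of_dependsOn {S : Type v} [MeasurableSpace S] [MeasurableSingletonClass S]
    [Countable S] {F : Set (ℕ → S)} {m : ℕ} (hF : DependsOn (· ∈ F) (Set.Iic m)) :
    MeasurableSet F := by
  have : F = Preorder.frestrictLe (π := fun _ => S) m ⁻¹' (Preorder.frestrictLe m '' F) := by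
    refine Set.Subset.antisymm (Set.subset_preimage_image _ _) ?_
    rintro ρ ⟨ρ', hρ', h⟩
    have := hF (x := ρ) (y := ρ') fun i hi => (congrFun h ⟨i, Finset.mem_Iic.2 hi⟩).symm
    exact this.mpr hρ'
  rw [this]
  exact (Set.to_countable _).measurableSet.preimage (by fun_prop)

/-- The runs that avoid `A` at the times `a, …, b`. -/
def avoids {S : Type v} (A : Set S) (a b : ℕ) : Set (ℕ → S) := {ρ | ∀ m, a ≤ m → m ≤ b → ρ m ∉ A}

/-- The runs that stay in `A` forever. -/
def stays {S : Type v} (A : Set S) : Set (ℕ → S) := {ρ | ∀ m, ρ m ∈ A}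

theorem dependsOn_avoids {S : Type v} (A : Set S) (a b : ℕ) :
    DependsOn (· ∈ avoids A a b) (Set.Iic b) := by
  intro ρ ρ' h
  refine propext (forall_congr' fun m => forall_congr' fun _ => forall_congr' fun hm => ?_)
  rw [h m hm]

section

variable {S : Type v} [MeasurableSpace S] [MeasurableSingletonClass S] [Finite S]

theorem measurableSet_avoids (A : Set S) (a b : ℕ) : MeasurableSet (avoids A a b) :=
  measurableSet_of_dependsOn (dependsOn_avoids A a b)

theorem measurableSet_visits (A : Set S) : MeasurableSet (visits A) := by
  have : visits A = ⋃ m, (fun ρ : ℕ → S => ρ m) ⁻¹' A := by ext; simp [visits]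
  rw [this]
  exact MeasurableSet.iUnion fun m => measurable_pi_apply m (Set.toFinite A).measurableSet

theorem measurableSet_stays (A : Set S) : MeasurableSet (stays A) := by
  have : stays A = ⋂ m, (fun ρ : ℕ → S => ρ m) ⁻¹' A := by ext; simp [stays]
  rw [this]
  exact MeasurableSet.iInter fun m => measurable_pi_apply m (Set.toFinite A).measurableSet

end

variable {k : ℕ} {S : Type v} (M : MarkovChain (Set (Marker k)) S)

/-- The states of good BSCCs with a marker `eᵢ` for which their BSCC is good. -/
def witnessStates : Set S :=
  {s | ∃ C, M.IsBSCC C ∧ s ∈ C ∧ ∃ i, M.IsGoodFor i C ∧ Marker.e i ∈ M.obs s}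

theorem mem_of_forall_edge {C : Set S} (hC : M.IsBSCC C) {ρ : ℕ → S}
    (hρ : ∀ i, M.Edge (ρ i) (ρ (i + 1))) {i j : ℕ} (hij : i ≤ j) (hi : ρ i ∈ C) : ρ j ∈ C := by
  induction j, hij using Nat.le_induction with
  | base => exact hi
  | succ j _ ih => exact hC.2 _ ih _ (hρ j)

theorem goodStates_of_forall_edge {ρ : ℕ → S} (hρ : ∀ i, M.Edge (ρ i) (ρ (i + 1))) {i j : ℕ}
    (hij : i ≤ j) (hi : ρ i ∈ M.goodStates) : ρ j ∈ M.goodStates := by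
  obtain ⟨C, hC, hiC, hg⟩ := hi
  exact ⟨C, hC, M.mem_of_forall_edge hC hρ hij hiC, hg⟩

theorem reaches_of_forall_edge {ρ : ℕ → S} (hρ : ∀ i, M.Edge (ρ i) (ρ (i + 1))) (j : ℕ) :
    M.Reaches (ρ 0) (ρ j) := by
  induction j with
  | zero => exact Relation.ReflTransGen.refl
  | succ j ih => exact ih.tail (hρ j)

theorem getLast?_map_range {T : Type*} (ρ : ℕ → T) (m : ℕ) :
    ((List.range (m + 1)).map ρ).getLast? = some (ρ m) := by
  simp [List.range_succ]

theorem pathLength_map_range {T : Type*} (ρ : ℕ → T) (m : ℕ) :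
    pathLength ((List.range (m + 1)).map ρ) = m := by
  simp [pathLength]

theorem secondHalf_map_range {T : Type*} (ρ : ℕ → T) (m : ℕ) :
    secondHalf ((List.range (2 * m + 1)).map ρ) =
      (List.range (m + 1)).map fun t => ρ (m + t) := by
  have h1 : 2 * m + 1 = m + (m + 1) := by ring
  have h2 : (2 * m + 1) / 2 = m := by omega
  rw [secondHalf, pathLength_map_range, h2, h1, List.range_add, List.map_append,
    List.drop_left' (by simp), List.map_map]
  rfl

variable [Finite S] [MeasurableSpace S] [MeasurableSingletonClass S]

/-- The progress probability, as an extended nonnegative real. -/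
def progressProbENN : ℝ≥0∞ :=
  min (min M.goodReachProb M.goodWitnessProb) (min M.badReachProb M.badWitnessProb)

theorem minProb_eq_top_or_le_one (A : Set S) (Prog : S → List S → Prop) (R : ℕ) :
    M.minProb A Prog R = ⊤ ∨ M.minProb A Prog R ≤ 1 := by
  rcases A.eq_empty_or_nonempty with rfl | ⟨s, hs⟩
  · left; simp [minProb]
  · right; exact (iInf₂_le s hs).trans prob_le_one

theorem progressProb_nonneg : 0 ≤ M.progressProb := ENNReal.toReal_nonneg

theorem progressProb_le_one : M.progressProb ≤ 1 := by
  have h : M.progressProbENN = ⊤ ∨ M.progressProbENN ≤ 1 := by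
    have h1 := M.minProb_eq_top_or_le_one (M.canReach M.goodStates \ M.goodStates)
      (M.IsReachPath M.goodStates) M.goodReachRadius
    have h2 := M.minProb_eq_top_or_le_one M.goodStates M.IsGoodWitnessPath M.goodWitnessRadius
    have h3 := M.minProb_eq_top_or_le_one (M.canReach M.badStates \ M.badStates)
      (M.IsReachPath M.badStates) M.badReachRadius
    have h4 := M.minProb_eq_top_or_le_one M.badStates M.IsBadWitnessPath M.badWitnessRadius
    rw [progressProbENN, goodReachProb, goodWitnessProb, badReachProb, badWitnessProb]
    simp only [min_eq_top, min_le_iff]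
    tauto
  change M.progressProbENN.toReal ≤ 1
  rcases h with h | h
  · simp [h]
  · exact ENNReal.toReal_le_of_le_ofReal zero_le_one (by simpa using h)

/-- Only the value `∞` needs care: it becomes `0` as a real number, which merely weakens the bound.
-/
theorem one_sub_progressProbENN_le : 1 - M.progressProbENN ≤ ENNReal.ofReal (1 - M.progressProb) := by
  change _ ≤ ENNReal.ofReal (1 - M.progressProbENN.toReal)
  by_cases h : M.progressProbENN = ⊤
  · simp [h]
  · rw [ENNReal.ofReal_sub _ ENNReal.toReal_nonneg, ENNReal.ofReal_one, ENNReal.ofReal_toReal h]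

theorem progressProbENN_le_of_mem_canReach {s : S}
    (hs : s ∈ M.canReach M.goodStates \ M.goodStates) :
    M.progressProbENN ≤ M.runMeasureFrom s (avoids M.goodStates 0 M.progressRadius)ᶜ := by
  refine (min_le_left _ _).trans ((min_le_left _ _).trans ((iInf₂_le s hs).trans
    (measure_mono ?_)))
  rintro ρ ⟨m, hm, -, t, ht, ht'⟩ h
  rw [getLast?_map_range, Option.some_inj] at ht'
  exact h m (Nat.zero_le _) (hm.trans ((le_max_left _ _).trans (le_max_left _ _))) (ht' ▸ ht)

/-- Progress paths have at least one step, so the witness occurs at a time `≥ 1`. Starting the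
window at `1` keeps the windows disjoint when they are concatenated. -/
theorem progressProbENN_le_of_mem_goodStates {s : S} (hs : s ∈ M.goodStates) :
    M.progressProbENN ≤ M.runMeasureFrom s (avoids M.witnessStates 1 M.progressRadius)ᶜ := by
  refine (min_le_left _ _).trans ((min_le_right _ _).trans ((iInf₂_le s hs).trans
    (measure_mono_ae ?_)))
  filter_upwards [M.runMeasureFrom_ae_zero s, M.runMeasureFrom_ae_edge s] with ρ h0 hρ
  rintro ⟨m, hm, ⟨-, -, hlen⟩, C, hC, hsC, i, hi, t, ht, hti⟩ h
  rw [pathLength_map_range] at hlen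
  rw [getLast?_map_range, Option.some_inj] at ht
  refine h m hlen (hm.trans ((le_max_right _ _).trans (le_max_left _ _))) ?_
  exact ⟨C, hC, M.mem_of_forall_edge hC hρ (Nat.zero_le m) (h0 ▸ hsC), i, hi, ht ▸ hti⟩

/-- The event is null if `s` is good or cannot reach a good state. Otherwise entering within the
window has probability at least `p = progressProbENN` and implies a visit, leaving at most
`Pr[visit] - p ≤ (1 - p) * Pr[visit]`. Keeping the factor `Pr[visit]` is what finally makes the
error proportional to `h`. -/
theorem runMeasureFrom_avoids_inter_visits_le (s : S) :
    M.runMeasureFrom s (avoids M.goodStates 0 M.progressRadius ∩ visits M.goodStates) ≤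
      (1 - M.progressProbENN) * M.runMeasureFrom s (visits M.goodStates) := by
  by_cases hs : s ∈ M.goodStates
  · refine le_of_eq_of_le (measure_eq_zero_iff_ae_notMem.2 ?_) zero_le
    filter_upwards [M.runMeasureFrom_ae_zero s] with ρ h0 h
    exact h.1 0 le_rfl (Nat.zero_le _) (h0 ▸ hs)
  by_cases hs' : s ∈ M.canReach M.goodStates
  · have h1 := M.progressProbENN_le_of_mem_canReach ⟨hs', hs⟩
    set F := avoids M.goodStates 0 M.progressRadius with hF
    have hsub : Fᶜ ⊆ visits M.goodStates := by
      intro ρ hρ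
      by_contra hv
      exact hρ fun m _ _ hm => hv ⟨m, hm⟩
    have h2 := measure_inter_add_sdiff (μ := M.runMeasureFrom s) (visits M.goodStates)
      (measurableSet_avoids M.goodStates 0 M.progressRadius)
    rw [← hF, Set.sdiff_eq, Set.inter_eq_right.2 hsub, Set.inter_comm] at h2
    have h3 : M.runMeasureFrom s (F ∩ visits M.goodStates) =
        M.runMeasureFrom s (visits M.goodStates) - M.runMeasureFrom s Fᶜ :=
      ENNReal.eq_sub_of_add_eq (measure_ne_top _ _) h2
    rw [h3, ENNReal.sub_mul fun _ _ => measure_ne_top _ _, one_mul]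
    refine tsub_le_tsub_left ?_ _
    exact (mul_le_of_le_one_right zero_le prob_le_one).trans h1
  · refine le_of_eq_of_le (measure_eq_zero_iff_ae_notMem.2 ?_) zero_le
    filter_upwards [M.runMeasureFrom_ae_zero s, M.runMeasureFrom_ae_edge s] with ρ h0 hρ h
    obtain ⟨m, hm⟩ := h.2
    exact hs' ⟨ρ m, hm, h0 ▸ M.reaches_of_forall_edge hρ m⟩

theorem runMeasureFrom_avoids_mul_inter_visits_le (j : ℕ) (s : S) :
    M.runMeasureFrom s (avoids M.goodStates 0 (j * M.progressRadius) ∩ visits M.goodStates) ≤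
      (1 - M.progressProbENN) ^ j * M.runMeasureFrom s (visits M.goodStates) := by
  induction j generalizing s with
  | zero => simpa using measure_mono Set.inter_subset_right
  | succ j ih =>
    set R := M.progressRadius
    -- The visit happens after time `(j + 1) * R`, so it is still ahead after the shift by `R`.
    have h1 : avoids M.goodStates 0 ((j + 1) * R) ∩ visits M.goodStates ⊆
        avoids M.goodStates 0 R ∩
          shiftRun R ⁻¹' (avoids M.goodStates 0 (j * R) ∩ visits M.goodStates) := by
      rintro ρ ⟨ha, m, hm⟩
      have hR : (j + 1) * R = R + j * R := by ring
      have hlt : R + j * R < m := by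
        by_contra hle
        exact ha m (Nat.zero_le _) (by omega) hm
      refine ⟨fun i hi hi' => ha i hi (by omega), fun i hi hi' => ha _ (Nat.zero_le _) (by omega),
        m - R, ?_⟩
      rw [shiftRun_apply, Nat.add_sub_cancel' (by omega)]
      exact hm
    have h2 : avoids M.goodStates 0 R ∩ shiftRun R ⁻¹' visits M.goodStates ⊆
        avoids M.goodStates 0 R ∩ visits M.goodStates := by
      rintro ρ ⟨ha, m, hm⟩
      exact ⟨ha, R + m, hm⟩
    calc _ ≤ _ := measure_mono h1
      _ ≤ _ := M.runMeasureFrom_inter_shift_le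
          ((measurableSet_avoids _ _ _).inter (measurableSet_visits _)) (measurableSet_visits _) _ R s
          (measurableSet_avoids _ _ _) (dependsOn_avoids _ _ _) fun ρ _ => ih (ρ R)
      _ ≤ (1 - M.progressProbENN) ^ j *
            ((1 - M.progressProbENN) * M.runMeasureFrom s (visits M.goodStates)) := by
          gcongr
          exact (measure_mono h2).trans (M.runMeasureFrom_avoids_inter_visits_le s)
      _ = _ := by rw [← mul_assoc, ← pow_succ]

theorem runMeasureFrom_avoids_witnessStates_le {s : S} (hs : s ∈ M.goodStates) :
    M.runMeasureFrom s (avoids M.witnessStates 1 M.progressRadius) ≤ 1 - M.progressProbENN := by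
  rw [← compl_compl (avoids M.witnessStates 1 M.progressRadius),
    prob_compl_eq_one_sub (measurableSet_avoids _ _ _).compl]
  exact tsub_le_tsub_left (M.progressProbENN_le_of_mem_goodStates hs) _

/-- Each window of `R_m` steps from a good state misses the witnesses with probability at most `1 -
progressProbENN`. Intersecting with `stays` makes the event null from other states, so the induction
may range over all `s`. -/
theorem runMeasureFrom_avoids_mul_inter_stays_le (j : ℕ) (s : S) :
    M.runMeasureFrom s (avoids M.witnessStates 1 (j * M.progressRadius) ∩ stays M.goodStates) ≤
      (1 - M.progressProbENN) ^ j := by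
  induction j generalizing s with
  | zero => simpa using prob_le_one
  | succ j ih =>
    by_cases hs : s ∈ M.goodStates
    · set R := M.progressRadius
      have hR : (j + 1) * R = R + j * R := by ring
      have h1 : avoids M.witnessStates 1 ((j + 1) * R) ∩ stays M.goodStates ⊆
          avoids M.witnessStates 1 R ∩
            shiftRun R ⁻¹' (avoids M.witnessStates 1 (j * R) ∩ stays M.goodStates) := by
        rintro ρ ⟨ha, hst⟩
        exact ⟨fun i hi hi' => ha i hi (by omega), fun i hi hi' => ha _ (by omega) (by omega),
          fun i => hst (R + i)⟩
      calc _ ≤ _ := measure_mono h1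
        _ ≤ _ := M.runMeasureFrom_inter_shift_le
            ((measurableSet_avoids _ _ _).inter (measurableSet_stays _)) MeasurableSet.univ
            ((1 - M.progressProbENN) ^ j) R s
            (measurableSet_avoids _ _ _) (dependsOn_avoids _ _ _)
            fun ρ _ => by simpa using ih (ρ R)
        _ ≤ (1 - M.progressProbENN) ^ j * (1 - M.progressProbENN) := by
            gcongr
            simpa using M.runMeasureFrom_avoids_witnessStates_le hs
        _ = _ := by rw [← pow_succ]
    · refine le_of_eq_of_le (measure_eq_zero_iff_ae_notMem.2 ?_) zero_le
      filter_upwards [M.runMeasureFrom_ae_zero s] with ρ h0 h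
      exact hs (h0 ▸ h.2 0)

end Progress

/-! ### The probability that a run of `M` is rejected. -/

section Restart

universe v

/-- The strategy with blocks of `2 * b` steps restarts after a path with the observations `π`. -/
def IsRejected {k : ℕ} (b : ℕ) (π : List (Set (Marker k))) : Prop :=
  2 * b ∣ pathLength π ∧ ¬ IsGoodPath (secondHalf π)

variable {k : ℕ} {S : Type v} (M : MarkovChain (Set (Marker k)) S)

/-- The runs with a prefix after which the strategy with blocks of `2 * b` steps restarts. -/
def rejectedRuns (b : ℕ) : Set (ℕ → S) :=
  {ρ | ∃ i, IsRejected b ((List.range (i + 1)).map fun j => M.obs (ρ j))}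

/-- If the second half starts in a good BSCC, it never leaves it. A witness state there would supply
some `eᵢ` for which the whole BSCC is free of `fᵢ`, making the second half good. -/
theorem exists_witness_of_isRejected [Nonempty (Fin k)] {b i : ℕ} {ρ : ℕ → S}
    (h : IsRejected b ((List.range (i + 1)).map fun j => M.obs (ρ j)))
    (hρ : ∀ i, M.Edge (ρ i) (ρ (i + 1))) :
    ∃ J, 1 ≤ J ∧ (ρ (b * J) ∈ M.goodStates →
      shiftRun (b * J) ρ ∈ avoids M.witnessStates 1 (b * J)) := by
  obtain ⟨⟨J, hJ⟩, hbad⟩ := h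
  rw [pathLength_map_range] at hJ
  obtain rfl : i = 2 * (b * J) := by rw [hJ, mul_assoc]
  rw [secondHalf_map_range] at hbad
  have i₀ : Fin k := Classical.arbitrary _
  -- For `J = 0` the path has length `0` and is good; this needs an index `i₀`, as goodness is
  -- existential in `i`.
  rcases Nat.eq_zero_or_pos J with rfl | hJ0
  · exact (hbad ⟨i₀, Or.inl (by simp)⟩).elim
  refine ⟨J, hJ0, fun hgood t _ ht2 hW => hbad ?_⟩
  obtain ⟨C', hC', hmem', -⟩ := hgood
  obtain ⟨C, hC, hmem, i, hi, he⟩ := hW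
  have hCC : C' = C := IsSCC.eq_of_mem M hC'.1 hC.1
    (M.mem_of_forall_edge hC' hρ (Nat.le_add_right _ t) hmem') hmem
  subst hCC
  refine ⟨i, Or.inr ⟨⟨_, List.mem_map.2 ⟨t, List.mem_range.2 (by omega), rfl⟩, he⟩, ?_⟩⟩
  intro α hα
  obtain ⟨t', -, rfl⟩ := List.mem_map.1 hα
  exact hi.2 _ (M.mem_of_forall_edge hC' hρ (Nat.le_add_right _ t') hmem')

variable [Finite S] [MeasurableSpace S] [MeasurableSingletonClass S]

theorem runMeasure_rejectedRuns_le_tsum [Nonempty (Fin k)] (b : ℕ) :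
    M.runMeasure (M.rejectedRuns b) ≤ M.runMeasure (visits M.goodStates)ᶜ +
      (1 - M.progressProbENN) ^ (b / M.progressRadius) * M.runMeasure (visits M.goodStates) +
      ∑' j : ℕ, ((1 - M.progressProbENN) ^ (b / M.progressRadius)) ^ (j + 1) *
        M.runMeasure (visits M.goodStates) := by
  set R := M.progressRadius with hR
  set q := 1 - M.progressProbENN with hq
  have hbR : b / R * R ≤ b := Nat.div_mul_le_self b R
  -- The index `j` stands for a rejection at length `2 * b * (j + 1)`. `A j` concerns the middle of
  -- that path and supplies the factor `Pr[visit]`; `B j` concerns the second half.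
  let A (j : ℕ) : Set (ℕ → S) := {ρ | ρ (b * (j + 1)) ∈ M.goodStates}
  let B (j : ℕ) : Set (ℕ → S) :=
    avoids M.witnessStates 1 (b / R * (j + 1) * R) ∩ stays M.goodStates
  have hA : ∀ j, DependsOn (· ∈ A j) (Set.Iic (b * (j + 1))) := by
    intro j ρ ρ' h
    refine propext ?_
    change (ρ (b * (j + 1)) ∈ M.goodStates) ↔ (ρ' (b * (j + 1)) ∈ M.goodStates)
    rw [h _ (Set.mem_Iic.2 le_rfl)]
  have hterm : ∀ j, M.runMeasure (A j ∩ shiftRun (b * (j + 1)) ⁻¹' B j) ≤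
      (q ^ (b / R)) ^ (j + 1) * M.runMeasure (visits M.goodStates) := by
    intro j
    rw [← pow_mul]
    refine (M.runMeasureFrom_inter_shift_le
      ((measurableSet_avoids _ _ _).inter (measurableSet_stays _)) MeasurableSet.univ
      (q ^ (b / R * (j + 1))) _ M.init (measurableSet_of_dependsOn (hA j)) (hA j)
      fun ρ _ => ?_).trans ?_
    · rw [measure_univ, mul_one]
      exact M.runMeasureFrom_avoids_mul_inter_stays_le _ _
    · exact mul_le_mul' le_rfl (measure_mono fun ρ hρ => ⟨_, hρ.1⟩)
  have hcover : M.rejectedRuns b ≤ᵐ[M.runMeasure] ((visits M.goodStates)ᶜ ∪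
      (avoids M.goodStates 0 (b / R * R) ∩ visits M.goodStates) ∪
      ⋃ j, A j ∩ shiftRun (b * (j + 1)) ⁻¹' B j : Set (ℕ → S)) := by
    filter_upwards [M.runMeasureFrom_ae_edge M.init] with ρ hρ
    rintro ⟨i, hi⟩
    obtain ⟨J, hJ, hJ'⟩ := M.exists_witness_of_isRejected hi hρ
    by_cases hv : ρ ∈ visits M.goodStates
    swap; · exact Or.inl (Or.inl hv)
    by_cases ha : ρ ∈ avoids M.goodStates 0 (b / R * R)
    · exact Or.inl (Or.inr ⟨ha, hv⟩)
    right
    obtain ⟨m, hm, hmG⟩ : ∃ m, m ≤ b ∧ ρ m ∈ M.goodStates := by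
      by_contra hno
      push Not at hno
      exact ha fun m _ hm => hno m (hm.trans hbR)
    obtain ⟨j, rfl⟩ := Nat.exists_eq_add_of_le' hJ
    have hstay : ∀ t, b ≤ t → ρ t ∈ M.goodStates := fun t ht =>
      M.goodStates_of_forall_edge hρ (hm.trans ht) hmG
    have hbj : b ≤ b * (j + 1) := Nat.le_mul_of_pos_right b (Nat.succ_pos j)
    have hle : b / R * (j + 1) * R ≤ b * (j + 1) := by
      calc b / R * (j + 1) * R = b / R * R * (j + 1) := by ring
        _ ≤ _ := by gcongr
    refine Set.mem_iUnion.2 ⟨j, hstay _ hbj, fun t ht ht' => ?_, fun t => ?_⟩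
    · exact hJ' (hstay _ hbj) t ht (ht'.trans hle)
    · exact hstay _ (hbj.trans (Nat.le_add_right _ _))
  refine (measure_mono_ae hcover).trans ((measure_union_le _ _).trans (add_le_add
    ((measure_union_le _ _).trans (add_le_add le_rfl ?_)) ?_))
  · exact M.runMeasureFrom_avoids_mul_inter_visits_le _ _
  · exact (measure_iUnion_le _).trans (ENNReal.tsum_le_tsum hterm)

theorem add_div_one_sub_le {q y : ℝ} (hq0 : 0 ≤ q) (hq1 : q ≤ 1) (hy0 : 0 ≤ y) (hy : 3 * y ≤ 1) :
    q * y + q * y / (1 - q * y) ≤ 3 * y := by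
  have hx : q * y ≤ y := mul_le_of_le_one_left hy0 hq1
  have hx0 : 0 ≤ q * y := mul_nonneg hq0 hy0
  have h1 : q * y / (1 - q * y) ≤ 2 * y := by
    rw [div_le_iff₀ (by linarith)]
    nlinarith
  linarith

theorem runMeasure_rejectedRuns_le (b : ℕ) :
    M.runMeasure (M.rejectedRuns b) ≤ ENNReal.ofReal
      (1 - M.goodProb * (1 - 3 * (1 - M.progressProb) ^ (b / M.progressRadius - 1))) := by
  have hg0 : 0 ≤ M.goodProb := measureReal_nonneg
  set N := b / M.progressRadius with hN
  set q : ℝ := 1 - M.progressProb with hq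
  have hq0 : 0 ≤ q := sub_nonneg.2 M.progressProb_le_one
  have hq1 : q ≤ 1 := sub_le_self _ M.progressProb_nonneg
  rcases isEmpty_or_nonempty (Fin k) with hk | hk
  -- Without markers no run is good, and the bound is `1`.
  · have : M.goodProb = 0 := by
      simp [goodProb, RabinLanguage]
    simpa [this] using prob_le_one
  by_cases hy : 3 * q ^ (N - 1) ≤ 1
  swap
  · refine prob_le_one.trans ?_
    rw [← ENNReal.ofReal_one]
    refine ENNReal.ofReal_le_ofReal ?_
    nlinarith
  -- For `N = 0` the truncated exponent would give `3 ≤ 1` in `hy`.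
  have hN1 : N - 1 + 1 = N := by
    rcases Nat.eq_zero_or_pos N with h | h
    · rw [h] at hy; norm_num at hy
    · omega
  have hy0 : 0 ≤ q ^ (N - 1) := pow_nonneg hq0 _
  have hxy : q ^ N = q * q ^ (N - 1) := by rw [← hN1, pow_succ']; simp
  set y := q ^ (N - 1)
  have hx0 : 0 ≤ q * y := mul_nonneg hq0 hy0
  have hx1 : q * y ≤ y := mul_le_of_le_one_left hy0 hq1
  have hqE : (1 - M.progressProbENN) ^ N ≤ ENNReal.ofReal (q * y) := by
    rw [← hxy, ENNReal.ofReal_pow hq0]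
    exact pow_le_pow_left' M.one_sub_progressProbENN_le N
  set h := M.runMeasure.real (visits M.goodStates) with hh
  have hgh : M.goodProb ≤ h := M.goodProb_le
  have hh1 : h ≤ 1 := measureReal_le_one
  have hhE : M.runMeasure (visits M.goodStates) = ENNReal.ofReal h :=
    (ENNReal.ofReal_toReal (measure_ne_top _ _)).symm
  have hh0 : 0 ≤ h := hg0.trans hgh
  have hfrac : 0 ≤ q * y / (1 - q * y) := div_nonneg hx0 (by linarith)
  have hsum : ∑' j : ℕ, ((1 - M.progressProbENN) ^ N) ^ (j + 1) *
      M.runMeasure (visits M.goodStates) ≤ ENNReal.ofReal (q * y / (1 - q * y) * h) := by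
    rw [ENNReal.tsum_mul_right, hhE, ENNReal.ofReal_mul hfrac]
    gcongr
    calc _ ≤ ∑' j : ℕ, ENNReal.ofReal (q * y) * ENNReal.ofReal (q * y) ^ j :=
          ENNReal.tsum_le_tsum fun j => by rw [← pow_succ']; gcongr
      _ = _ := by
        rw [ENNReal.tsum_mul_left, ENNReal.tsum_geometric, div_eq_mul_inv, ENNReal.ofReal_mul hx0,
          ENNReal.ofReal_inv_of_pos (by linarith), ENNReal.ofReal_sub _ hx0, ENNReal.ofReal_one]
  refine (M.runMeasure_rejectedRuns_le_tsum b).trans ?_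
  rw [prob_compl_eq_one_sub (measurableSet_visits _)]
  calc _ ≤ ENNReal.ofReal (1 - h) + ENNReal.ofReal (q * y * h) +
        ENNReal.ofReal (q * y / (1 - q * y) * h) := by
        refine add_le_add (add_le_add ?_ ?_) hsum
        · rw [hhE, ENNReal.ofReal_sub _ hh0, ENNReal.ofReal_one]
        · rw [hhE, ENNReal.ofReal_mul hx0]
          gcongr
    _ = ENNReal.ofReal (1 - h + q * y * h + q * y / (1 - q * y) * h) := by
        rw [ENNReal.ofReal_add (by nlinarith) (by positivity),
          ENNReal.ofReal_add (by linarith) (by positivity)]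
    _ ≤ _ := by
        refine ENNReal.ofReal_le_ofReal ?_
        have := add_div_one_sub_le hq0 hq1 hy0 hy
        have h1 : (q * y + q * y / (1 - q * y)) * h ≤ 3 * y * h := by gcongr
        have h2 : M.goodProb * (1 - 3 * y) ≤ h * (1 - 3 * y) := by
          gcongr
        linarith

end Restart

/-! ### Comparison of the restart process with `M`. -/

section RestartChain

universe u v w

theorem tsum_pmf_map_mul {α : Type u} {β : Type v} (p : PMF α) (φ : α → β) (F : β → ℝ≥0∞) :
    ∑' b, p.map φ b * F b = ∑' a, p a * F (φ a) := by
  classical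
  simp_rw [PMF.map_apply, ← ENNReal.tsum_mul_right]
  rw [ENNReal.tsum_comm]
  refine tsum_congr fun a => ?_
  rw [tsum_eq_single (φ a) fun b hb => by simp [hb]]
  simp

theorem countRestarts_append {T : Type u} (l l' : List (T × Action)) :
    countRestarts (l ++ l') = countRestarts l + countRestarts l' := by
  simp [countRestarts]

theorem countRestarts_singleton_continue {T : Type u} (x : T) :
    countRestarts [(x, Action.continue)] = 0 := by
  simp [countRestarts]

theorem countRestarts_singleton_restart {T : Type u} (x : T) :
    countRestarts [(x, Action.restart)] = 1 := by
  simp [countRestarts]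

theorem countRestarts_map {T : Type u} {T' : Type v} (g : T → T') (l : List (T × Action)) :
    countRestarts (l.map fun p => (g p.1, p.2)) = countRestarts l := by
  simp [countRestarts, List.countP_map, Function.comp_def]

theorem currentPath_nil {T : Type u} (y : T) : currentPath [] y = [y] := by
  simp [currentPath]

theorem currentPath_append_restart {T : Type u} (l : List (T × Action)) (x y : T) :
    currentPath (l ++ [(x, Action.restart)]) y = [y] := by
  simp [currentPath]

theorem currentPath_append_continue {T : Type u} (l : List (T × Action)) (x y : T) :
    currentPath (l ++ [(x, Action.continue)]) y = currentPath l x ++ [y] := by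
  simp [currentPath]

/-- Lets the strategy, which reads observations, be analysed on the underlying states. -/
theorem currentPath_map {T : Type u} {T' : Type v} (g : T → T') (l : List (T × Action)) (y : T) :
    currentPath (l.map fun p => (g p.1, p.2)) (g y) = (currentPath l y).map g := by
  induction l using List.reverseRecOn generalizing y with
  | nil => simp [currentPath_nil]
  | append_singleton l p ih =>
    obtain ⟨x, _ | _⟩ := p
    · simp [currentPath_append_restart]
    · simp [currentPath_append_continue, ih]

theorem natCast_le_numRestarts_iff {S : Type v} (n : ℕ) (ρ : ℕ → History S Action) :
    (n : ℕ∞) ≤ numRestarts ρ ↔ ∃ i, n ≤ countRestarts (ρ i).past := by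
  cases n with
  | zero => simp
  | succ n =>
    rw [Nat.cast_add, Nat.cast_one, ENat.add_one_le_iff (ENat.natCast_ne_top n), numRestarts,
      lt_iSup_iff]
    simp

variable {k : ℕ} {S : Type v} (M : MarkovChain (Set (Marker k)) S) (f : ℕ → ℕ)

/-- The restart process of `M`, controlled by the strategy. -/
def restartChain : MarkovChain (Set (Marker k)) (History S Action) :=
  M.restartMDP.induced (strategy f)

/-- The condition under which the strategy restarts after the history `g`. -/
def RestartsAt (g : History S Action) : Prop :=
  IsRejected (f (countRestarts g.past)) ((currentPath g.past g.last).map M.obs)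

theorem choice_eq_restart {g : History S Action} (h : M.RestartsAt f g) :
    M.restartMDP.choice (strategy f) g = Action.restart := by
  have h' := h
  rw [RestartsAt, ← currentPath_map, ← countRestarts_map M.obs] at h'
  exact if_pos h'

theorem choice_eq_continue {g : History S Action} (h : ¬ M.RestartsAt f g) :
    M.restartMDP.choice (strategy f) g = Action.continue := by
  have h' := h
  rw [RestartsAt, ← currentPath_map, ← countRestarts_map M.obs] at h'
  exact if_neg h'

theorem restartChain_P_of_not_restartsAt {g : History S Action} (h : ¬ M.RestartsAt f g) :
    (M.restartChain f).P g =
      (M.P g.last).map fun t => ⟨g.past ++ [(g.last, Action.continue)], t⟩ := by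
  simp only [restartChain, MDP.induced, M.choice_eq_continue f h]
  rfl

theorem restartChain_P_of_restartsAt {g : History S Action} (h : M.RestartsAt f g) :
    (M.restartChain f).P g =
      PMF.pure ⟨g.past ++ [(g.last, Action.restart)], M.init⟩ := by
  simp only [restartChain, MDP.induced, M.choice_eq_restart f h]
  exact PMF.pure_map _ _

theorem restartChain_edge {g g' : History S Action} (h : (M.restartChain f).Edge g g') :
    g' = ⟨g.past ++ [(g.last, Action.restart)], M.init⟩ ∨
      ∃ t, g' = ⟨g.past ++ [(g.last, Action.continue)], t⟩ := by
  by_cases hr : M.RestartsAt f g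
  · left
    rw [Edge, M.restartChain_P_of_restartsAt f hr] at h
    by_contra hne
    simp [PMF.pure_apply, hne] at h
  · right
    have h' : g' ∈ ((M.restartChain f).P g).support := (PMF.mem_support_iff _ _).2 h.ne'
    rw [M.restartChain_P_of_not_restartsAt f hr, PMF.mem_support_map_iff] at h'
    obtain ⟨t, -, rfl⟩ := h'
    exact ⟨t, rfl⟩

/-- The runs with more than `n` restarts in the first `m` steps. -/
def restartsBy (S : Type v) (n m : ℕ) : Set (ℕ → History S Action) :=
  {ρ | ∃ i ≤ m, n + 1 ≤ countRestarts (ρ i).past}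

/-- The runs that the strategy rejects in the first `m` steps, when started after the path `π`. -/
def rejectedBy (b : ℕ) (π : List S) (m : ℕ) : Set (ℕ → S) :=
  {ρ | ∃ i ≤ m, IsRejected b ((π ++ (List.range (i + 1)).map ρ).map M.obs)}

theorem dependsOn_restartsBy (n m : ℕ) : DependsOn (· ∈ restartsBy S n m) (Set.Iic m) := by
  intro ρ ρ' h
  refine propext (exists_congr fun i => and_congr_right fun hi => ?_)
  rw [h i hi]

theorem dependsOn_rejectedBy (b : ℕ) (π : List S) (m : ℕ) :
    DependsOn (· ∈ M.rejectedBy b π m) (Set.Iic m) := by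
  intro ρ ρ' h
  refine propext (exists_congr fun i => and_congr_right fun hi => ?_)
  have : (List.range (i + 1)).map ρ = (List.range (i + 1)).map ρ' :=
    List.map_congr_left fun j hj => h j (by have := List.mem_range.1 hj; simp; omega)
  rw [this]

theorem mem_rejectedBy_succ {b m : ℕ} {π : List S} {s : S} {ρ : ℕ → S}
    (h : ρ ∈ M.rejectedBy b (π ++ [s]) m) : consRun s ρ ∈ M.rejectedBy b π (m + 1) := by
  obtain ⟨i, hi, h⟩ := h
  refine ⟨i + 1, Nat.succ_le_succ hi, ?_⟩
  convert h using 2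
  rw [List.range_succ_eq_map, List.map_cons, List.map_map, List.append_assoc]
  rfl

/-- The runs with at least `n` restarts. -/
def restartsAtLeast (S : Type v) (n : ℕ) : Set (ℕ → History S Action) :=
  {ρ | ∃ i, n ≤ countRestarts (ρ i).past}

theorem measurableSet_restartsAtLeast (n : ℕ) : MeasurableSet (restartsAtLeast S n) := by
  have : restartsAtLeast S n =
      ⋃ i, (fun ρ : ℕ → History S Action => ρ i) ⁻¹' {g | n ≤ countRestarts g.past} := by
    ext; simp [restartsAtLeast]
  rw [this]
  exact MeasurableSet.iUnion fun i => measurable_pi_apply i (MeasurableSet.of_discrete)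

/-- The histories that have just started or restarted, after `n` restarts. -/
def freshHistories (n : ℕ) : Set (History S Action) :=
  {g | countRestarts g.past = n ∧ g.last = M.init ∧ currentPath g.past g.last = [g.last]}

/-- The runs on histories in which the `n`-th restart has just happened at time `m`. -/
def restartTime (n m : ℕ) : Set (ℕ → History S Action) :=
  {ρ | ρ m ∈ M.freshHistories n ∧ ∀ i < m, countRestarts (ρ i).past < n}

theorem dependsOn_restartTime (n m : ℕ) : DependsOn (· ∈ M.restartTime n m) (Set.Iic m) := by
  intro ρ ρ' h
  refine propext (and_congr ?_ (forall_congr' fun i => forall_congr' fun hi => ?_))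
  · rw [h m (Set.mem_Iic.2 le_rfl)]
  · rw [h i (Set.mem_Iic.2 (le_of_lt hi))]

variable [Finite S]

/-- Take the first time at which the count reaches `n`. A step raises the count by at most one, so
the count is then exactly `n`, and the process has just restarted or, for `n = 0`, just started. -/
theorem ae_exists_mem_restartTime (n : ℕ) :
    ∀ᵐ ρ ∂(M.restartChain f).runMeasure, ρ ∈ restartsAtLeast S n → ∃ m, ρ ∈ M.restartTime n m := by
  classical
  filter_upwards [(M.restartChain f).runMeasureFrom_ae_zero _,
    (M.restartChain f).runMeasureFrom_ae_edge _] with ρ h0 hρ h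
  refine ⟨Nat.find h, ?_, fun i hi => not_le.1 (Nat.find_min h hi)⟩
  have hm := Nat.find_spec h
  have hmin := fun i (hi : i < Nat.find h) => not_le.1 (Nat.find_min h hi)
  generalize Nat.find h = m at hm hmin
  cases m with
  | zero =>
    rw [h0] at hm ⊢
    exact ⟨le_antisymm (by simp [restartChain, MDP.induced, countRestarts]) hm, rfl,
      currentPath_nil _⟩
  | succ m =>
    have hlt := hmin m (Nat.lt_succ_self m)
    rcases M.restartChain_edge f (hρ m) with h' | ⟨t, h'⟩
    · rw [h'] at hm ⊢
      rw [countRestarts_append, countRestarts_singleton_restart] at hm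
      refine ⟨?_, rfl, currentPath_append_restart _ _ _⟩
      rw [countRestarts_append, countRestarts_singleton_restart]
      omega
    · rw [h', countRestarts_append, countRestarts_singleton_continue] at hm
      omega

variable [MeasurableSpace S] [MeasurableSingletonClass S]

/-- A step-by-step coupling, by induction on the horizon: until rejection both chains move by the
same row of `M.P`, and at rejection the right-hand side is `1`. The prefix `π` remembers the path
since the last restart. -/
theorem runMeasureFrom_restartsBy_le (m : ℕ) (g : History S Action) (π : List S)
    (hg : currentPath g.past g.last = π ++ [g.last]) :
    (M.restartChain f).runMeasureFrom g (restartsBy S (countRestarts g.past) m) ≤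
      M.runMeasureFrom g.last (M.rejectedBy (f (countRestarts g.past)) π m) := by
  induction m generalizing g π with
  | zero =>
    refine le_of_eq_of_le (measure_eq_zero_iff_ae_notMem.2 ?_) zero_le
    filter_upwards [(M.restartChain f).runMeasureFrom_ae_zero g] with ρ h0
    rintro ⟨i, hi, h⟩
    rw [Nat.le_zero.1 hi, h0] at h
    omega
  | succ m ih =>
    by_cases hr : M.RestartsAt f g
    · have : M.runMeasureFrom g.last (M.rejectedBy (f (countRestarts g.past)) π (m + 1)) = 1 := by
        rw [← prob_compl_eq_zero_iff (measurableSet_of_dependsOn (M.dependsOn_rejectedBy _ _ _))]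
        refine measure_eq_zero_iff_ae_notMem.2 ?_
        filter_upwards [M.runMeasureFrom_ae_zero g.last] with ρ h0
        refine not_not.2 ⟨0, Nat.zero_le _, ?_⟩
        have hr' := hr
        rw [RestartsAt, hg] at hr'
        simpa [h0] using hr'
      rw [this]
      exact prob_le_one
    · rw [runMeasureFrom_step _ g (measurableSet_of_dependsOn (dependsOn_restartsBy _ _)),
        M.runMeasureFrom_step g.last (measurableSet_of_dependsOn (M.dependsOn_rejectedBy _ _ _)),
        M.restartChain_P_of_not_restartsAt f hr, tsum_pmf_map_mul]
      refine ENNReal.tsum_le_tsum fun t => mul_le_mul' le_rfl ?_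
      have hc : countRestarts (g.past ++ [(g.last, Action.continue)]) = countRestarts g.past := by
        rw [countRestarts_append, countRestarts_singleton_continue, add_zero]
      have h1 := ih ⟨g.past ++ [(g.last, Action.continue)], t⟩ (π ++ [g.last])
        (by rw [currentPath_append_continue, hg])
      rw [hc] at h1
      refine (measure_mono ?_).trans (h1.trans (measure_mono fun ρ h => M.mem_rejectedBy_succ h))
      rintro ρ ⟨i, hi, h⟩
      cases i with
      | zero => exact absurd h (by rw [consRun_zero]; omega)
      | succ i => exact ⟨i, Nat.succ_le_succ_iff.1 hi, h⟩

theorem runMeasureFrom_restartsAtLeast_le {n : ℕ} {g : History S Action}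
    (hg : g ∈ M.freshHistories n) :
    (M.restartChain f).runMeasureFrom g (restartsAtLeast S (n + 1)) ≤
      M.runMeasure (M.rejectedRuns (f n)) := by
  obtain ⟨rfl, hinit, hpath⟩ := hg
  have hU : restartsAtLeast S (countRestarts g.past + 1) =
      ⋃ m, restartsBy S (countRestarts g.past) m := by
    ext ρ
    simp only [restartsAtLeast, restartsBy, Set.mem_iUnion, Set.mem_ofPred_eq]
    exact ⟨fun ⟨i, h⟩ => ⟨i, i, le_rfl, h⟩, fun ⟨_, i, _, h⟩ => ⟨i, h⟩⟩
  have hmono : Monotone (restartsBy S (countRestarts g.past)) :=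
    fun m m' h ρ ⟨i, hi, h'⟩ => ⟨i, hi.trans h, h'⟩
  rw [hU, hmono.measure_iUnion]
  refine iSup_le fun m => (M.runMeasureFrom_restartsBy_le f m g [] hpath).trans ?_
  rw [hinit]
  refine measure_mono ?_
  rintro ρ ⟨i, -, h⟩
  refine ⟨i, ?_⟩
  simpa [Function.comp_def] using h

theorem runMeasure_restartsAtLeast_succ_le (n : ℕ) :
    (M.restartChain f).runMeasure (restartsAtLeast S (n + 1)) ≤
      M.runMeasure (M.rejectedRuns (f n)) * (M.restartChain f).runMeasure (restartsAtLeast S n) := by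
  set c := M.runMeasure (M.rejectedRuns (f n))
  have hT : ∀ m, MeasurableSet (M.restartTime n m) := fun m =>
    measurableSet_of_dependsOn (M.dependsOn_restartTime n m)
  have hcover : restartsAtLeast S (n + 1) ≤ᵐ[(M.restartChain f).runMeasure]
      (⋃ m, M.restartTime n m ∩ shiftRun m ⁻¹' restartsAtLeast S (n + 1) :
        Set (ℕ → History S Action)) := by
    filter_upwards [M.ae_exists_mem_restartTime f n] with ρ hρ
    rintro ⟨i, hi⟩
    obtain ⟨m, hm⟩ := hρ ⟨i, (Nat.le_succ n).trans hi⟩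
    refine Set.mem_iUnion.2 ⟨m, hm, i - m, ?_⟩
    have : m ≤ i := by
      by_contra hlt
      have := hm.2 i (not_le.1 hlt)
      omega
    rwa [shiftRun_apply, Nat.add_sub_cancel' this]
  -- The time of the `n`-th restart is unique, so the bounds conditional on it add up without loss.
  have hdisj : Pairwise (Function.onFun Disjoint (M.restartTime n)) := by
    refine fun m m' hne => Set.disjoint_left.2 fun ρ h h' => ?_
    rcases hne.lt_or_gt with hlt | hlt
    · exact (h'.2 m hlt).ne h.1.1
    · exact (h.2 m' hlt).ne h'.1.1
  calc _ ≤ _ := measure_mono_ae hcover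
    _ ≤ _ := measure_iUnion_le _
    _ ≤ ∑' m, c * (M.restartChain f).runMeasure (M.restartTime n m) := by
        refine ENNReal.tsum_le_tsum fun m => ?_
        have := (M.restartChain f).runMeasureFrom_inter_shift_le
          (measurableSet_restartsAtLeast (S := S) (n + 1)) MeasurableSet.univ c m
          (M.restartChain f).init (hT m) (M.dependsOn_restartTime n m) fun ρ hρ => by
            rw [measure_univ, mul_one]
            exact M.runMeasureFrom_restartsAtLeast_le f hρ.1
        rwa [Set.preimage_univ, Set.inter_univ] at this
    _ = c * (M.restartChain f).runMeasure (⋃ m, M.restartTime n m) := by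
        rw [ENNReal.tsum_mul_left, measure_iUnion hdisj hT]
    _ ≤ _ := by
        refine mul_le_mul' le_rfl (measure_mono (Set.iUnion_subset fun m ρ hρ => ⟨m, hρ.1.1.ge⟩))

end RestartChain

end MarkovChain

end BlackBox

end

theorem mainTheorem7 {k : ℕ} {S : Type*} [Finite S] [MeasurableSpace S]
    [MeasurableSingletonClass S] (M : BlackBox.MarkovChain (Set (BlackBox.Marker k)) S)
    (f : ℕ → ℕ) (n : ℕ) :
    (ProbabilityTheory.cond (M.restartMDP.induced (BlackBox.strategy f)).runMeasure
        {ρ | (n : ℕ∞) ≤ BlackBox.numRestarts ρ}).real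
        {ρ | ((n + 1 : ℕ) : ℕ∞) ≤ BlackBox.numRestarts ρ} ≤
      1 - M.goodProb * (1 - 3 * (1 - M.progressProb) ^ (f n / M.progressRadius - 1)) := by
  have hset : ∀ n : ℕ, {ρ | (n : ℕ∞) ≤ BlackBox.numRestarts ρ} =
      BlackBox.MarkovChain.restartsAtLeast S n := fun n =>
    Set.ext fun ρ => BlackBox.MarkovChain.natCast_le_numRestarts_iff n ρ
  rw [hset, hset]
  have hg0 : 0 ≤ M.goodProb := MeasureTheory.measureReal_nonneg
  have hg1 : M.goodProb ≤ 1 := MeasureTheory.measureReal_le_one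
  have hy : 0 ≤ (1 - M.progressProb) ^ (f n / M.progressRadius - 1) :=
    pow_nonneg (sub_nonneg.2 M.progressProb_le_one) _
  refine ENNReal.toReal_le_of_le_ofReal (by nlinarith [mul_nonneg hg0 hy])
    (le_trans ?_ (M.runMeasure_rejectedRuns_le (f n)))
  rw [ProbabilityTheory.cond_apply (BlackBox.MarkovChain.measurableSet_restartsAtLeast n)]
  set μ := (M.restartMDP.induced (BlackBox.strategy f)).runMeasure
  calc (μ (BlackBox.MarkovChain.restartsAtLeast S n))⁻¹ * μ (_ ∩ _) ≤
        (μ (BlackBox.MarkovChain.restartsAtLeast S n))⁻¹ *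
          (M.runMeasure (M.rejectedRuns (f n)) * μ (BlackBox.MarkovChain.restartsAtLeast S n)) :=
        mul_le_mul' le_rfl ((MeasureTheory.measure_mono Set.inter_subset_right).trans
          (M.runMeasure_restartsAtLeast_succ_le f n))
    _ = M.runMeasure (M.rejectedRuns (f n)) * ((μ (BlackBox.MarkovChain.restartsAtLeast S n))⁻¹ *
          μ (BlackBox.MarkovChain.restartsAtLeast S n)) := mul_left_comm _ _ _
    -- An inequality suffices and also covers a null conditioning event, where the product is `∞ * 0
    -- = 0`.
    _ ≤ _ := mul_le_of_le_one_right zero_le (ENNReal.inv_mul_le_one _)
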